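/- Let $G$ be a connected finite-dimensional real Lie group with Lie algebra $\mathfrak g$, and let $\mathfrak z$ be the centre of $\mathfrak g$. Assume that $G$ is step-two nilpotent in the sense that $[\mathfrak g,\mathfrak g]\subset\mathfrak z$. Let $\langle\cdot,\cdot\rangle$ be a scalar product on $\mathfrak g$, i.e. a non-degenerate symmetric bilinear form (not necessarily definite), whose restriction to $\mathfrak z$ is non-degenerate. Put $\mathfrak v=\{V\in\mathfrak g : \langle V,Z\rangle=0 \text{ for all } Z\in\mathfrak z\}$, so that $\mathfrak g=\mathfrak v\oplus\mathfrak z$, and write $U=U_{\mathfrak v}+U_{\mathfrak z}$ with $U_{\mathfrak v}\in\mathfrak v$ and $U_{\mathfrak z}\in\mathfrak z$ for $U\in\mathfrak g$. Let $j:\mathfrak z\to\mathrm{End}(\mathfrak v)$ be the linear map determined by $$\langle j(Z)V,V'\rangle=\langle [V,V'],Z\rangle\qquad (V,V'\in\mathfrak v,\ Z\in\mathfrak z).$$ For $Y\in\mathfrak g$ let $\mathcal O=\{(\mathrm{Ad}_g)^{\mathrm T}Y : g\in G\}$ be the coadjoint orbit through $Y$, where $(\mathrm{Ad}_g)^{\mathrm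 T}$ is the adjoint of $\mathrm{Ad}_g$ with respect to $\langle\cdot,\cdot\rangle$, i.e. $\langle(\mathrm{Ad}_g)^{\mathrm T}Y,X\rangle=\langle Y,\mathrm{Ad}_gX\rangle$ for all $X\in\mathfrak g$. Then, for every $Y\in\mathfrak g$, $$\mathcal O=\{Y+j(Y_{\mathfrak z})U_{\mathfrak v} : U\in\mathfrak g\}=Y+\mathrm{Im}\bigl(j(Y_{\mathfrak z})\bigr).$$ In particular, $\mathcal O$ is the affine subspace of $\mathfrak g$ through $Y$ with direction $\mathrm{Im}\bigl(j(Y_{\mathfrak z})\bigr)$. -/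

import Mathlib

open scoped Manifold ContDiff

/-- Over `ℝ`, the smoothness exponent that Mathlib requires for the Lie algebra of a Lie group is
`3`, so that a smooth Lie group satisfies it. -/
instance minSmoothnessRealThreeLEInfty : ENat.LEInfty (minSmoothness ℝ 3) :=
  ⟨by
    rw [minSmoothness_of_isRCLikeNormedField]
    exact ENat.LEInfty.out⟩

section LieAlgebra

variable {L : Type*} [LieRing L] [LieAlgebra ℝ L]

/-- The Lie algebra `L` is step-two nilpotent: `[L, L] ⊆ z`, where `z` is the centre of `L`. -/
def IsStepTwoNilpotent (L : Type*) [LieRing L] [LieAlgebra ℝ L] : Prop :=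
  ∀ U V : L, ⁅U, V⁆ ∈ LieAlgebra.center ℝ L

/-- `B` is a scalar product on `L` (a non-degenerate symmetric bilinear form, not necessarily
definite) whose restriction to the centre `z` of `L` is again non-degenerate. -/
structure IsCentralScalarProduct (B : LinearMap.BilinForm ℝ L) : Prop where
  isSymm : B.IsSymm
  nondegenerate : B.Nondegenerate
  nondegenerate_center : (B.restrict (LieAlgebra.center ℝ L).toSubmodule).Nondegenerate

/-- The orthogonal space `v = z^⊥` of the centre `z` of `L`. -/
def centerPerp (B : LinearMap.BilinForm ℝ L) : Submodule ℝ L :=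
  B.orthogonal (LieAlgebra.center ℝ L).toSubmodule

variable [FiniteDimensional ℝ L] {B : LinearMap.BilinForm ℝ L}

theorem IsCentralScalarProduct.isCompl (hB : IsCentralScalarProduct B) :
    IsCompl (centerPerp B) (LieAlgebra.center ℝ L).toSubmodule :=
  (LinearMap.BilinForm.isCompl_orthogonal_of_restrict_nondegenerate hB.isSymm.isRefl
    hB.nondegenerate_center).symm

theorem IsCentralScalarProduct.nondegenerate_centerPerp (hB : IsCentralScalarProduct B) :
    (B.restrict (centerPerp B)).Nondegenerate := by
  rw [LinearMap.BilinForm.restrict_nondegenerate_iff_isCompl_orthogonal hB.isSymm.isRefl]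
  have h := LinearMap.BilinForm.orthogonal_orthogonal hB.nondegenerate hB.isSymm.isRefl
    (LieAlgebra.center ℝ L).toSubmodule
  rw [centerPerp, h]
  exact hB.isCompl

/-- The component `Y_v` of `Y` in the decomposition `L = v ⊕ z`. -/
noncomputable def perpPart (hB : IsCentralScalarProduct B) : L →ₗ[ℝ] centerPerp B :=
  Submodule.projectionOnto _ _ hB.isCompl

/-- The component `Y_z` of `Y` in the decomposition `L = v ⊕ z`. -/
noncomputable def centerPart (hB : IsCentralScalarProduct B) :
    L →ₗ[ℝ] (LieAlgebra.center ℝ L).toSubmodule :=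
  Submodule.projectionOnto _ _ hB.isCompl.symm

theorem perpPart_add_centerPart (hB : IsCentralScalarProduct B) (Y : L) :
    (perpPart hB Y : L) + (centerPart hB Y : L) = Y :=
  by
  exact Submodule.projection_add_projection_eq_self hB.isCompl Y

/-- The bilinear form `(V, V') ↦ ⟨[V, V'], Z⟩` on `v`, depending linearly on `Z ∈ z`. -/
def bracketForm (B : LinearMap.BilinForm ℝ L) :
    (LieAlgebra.center ℝ L).toSubmodule →ₗ[ℝ] centerPerp B →ₗ[ℝ] Module.Dual ℝ (centerPerp B) :=
  LinearMap.mk₂ ℝ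
    (fun Z V => (B.flip (Z : L)) ∘ₗ (LieAlgebra.ad ℝ L (V : L)) ∘ₗ (centerPerp B).subtype)
    (by intros; ext; simp)
    (by intros; ext; simp)
    (by intros; ext; simp)
    (by intros; ext; simp)

/-- The `j`-mapping: `j(Z)` is the endomorphism of `v` with `⟨j(Z) V, V'⟩ = ⟨[V, V'], Z⟩` for all
`V, V' ∈ v`; see `jMap_spec`. -/
noncomputable def jMap (hB : IsCentralScalarProduct B) :
    (LieAlgebra.center ℝ L).toSubmodule →ₗ[ℝ] Module.End ℝ (centerPerp B) where
  toFun Z := ((B.restrict (centerPerp B)).toDual hB.nondegenerate_centerPerp).symm ∘ₗ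
    bracketForm B Z
  map_add' _ _ := by ext; simp
  map_smul' _ _ := by ext; simp

theorem jMap_spec (hB : IsCentralScalarProduct B) (Z : (LieAlgebra.center ℝ L).toSubmodule)
    (V V' : centerPerp B) :
    B (jMap hB Z V : L) (V' : L) = B ⁅(V : L), (V' : L)⁆ (Z : L) :=
  LinearMap.BilinForm.apply_toDual_symm_apply (hB := hB.nondegenerate_centerPerp)
    (f := bracketForm B Z V) V'

end LieAlgebra

section LieGroup

variable {n : ℕ} {G : Type*} [TopologicalSpace G] [ChartedSpace (EuclideanSpace ℝ (Fin n)) G]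
  [Group G]

instance groupLieAlgebraFiniteDimensional : FiniteDimensional ℝ (GroupLieAlgebra (𝓡 n) G) :=
  inferInstanceAs (FiniteDimensional ℝ (EuclideanSpace ℝ (Fin n)))

/-- The adjoint action `Ad_g` on the Lie algebra of `G`: the differential at `1` of the conjugation
`x ↦ g * x * g⁻¹`. (Its values are tangent vectors at `g * 1 * g⁻¹ = 1`.) -/
noncomputable def adjointAction (g : G) :
    GroupLieAlgebra (𝓡 n) G →ₗ[ℝ] GroupLieAlgebra (𝓡 n) G :=
  (mfderiv (𝓡 n) (𝓡 n) (fun x : G => g * x * g⁻¹) 1).toLinearMap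

/-- The coadjoint orbit `{(Ad_g)^T Y | g ∈ G}` through `Y`, where `^T` is the adjoint with respect
to the scalar product `B` on the Lie algebra: `⟨(Ad_g)^T Y, X⟩ = ⟨Y, Ad_g X⟩`. -/
def coadjointOrbit (B : LinearMap.BilinForm ℝ (GroupLieAlgebra (𝓡 n) G)) (hB : B.Nondegenerate)
    (Y : GroupLieAlgebra (𝓡 n) G) : Set (GroupLieAlgebra (𝓡 n) G) :=
  Set.range fun g : G => B.leftAdjointOfNondegenerate hB (adjointAction g) Y

end LieGroup

/-!
Write `Ad`, `ad` for the adjoint actions of `G` and of its Lie algebra `L`. Everything rests on the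
identity of sets `{Ad g | g ∈ G} = {1 + ad U | U ∈ L}`: the transpose of `1 + ad U` sends `Y` to
`Y + j(Y_z) U_v` (`leftAdjointOfNondegenerate_eq_add_jMap`), since `[U, X]` is central and only
depends on `U_v` and `X_v`.

The identity is obtained without the exponential map. Two facts about `Ad` are needed: it is
multiplicative, and its differential at `1` is `ad`. For the second, read the multiplication in the
preferred chart `φ` around `1`, as `m(x, y) = φ(φ⁻¹ x * φ⁻¹ y)`, and let `e = φ 1`. The
relation `dR_g ∘ Ad g = dL_g` becomes `D₁m(e, x) ∘ Ad (φ⁻¹ x) = D₂m(x, e)` for `x` near `e`, which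
shows that `Ad` is smooth near `1` and, by the symmetry of the second derivative of `m`, that its
differential is `D₁D₂m(v, w) - D₁D₂m(w, v)` (`fderiv_adjointCLM_apply`). The same expression is the
bracket of the left-invariant fields `x ↦ D₂m(x, e) v` and `x ↦ D₂m(x, e) w`
(`groupLieAlgebra_bracket_eq`).

By multiplicativity, the derivative of `Ad` at `g` in the left-translated direction of `v` is
`Ad g ∘ ad v`, so, `G` being connected, a linear map vanishing on all of these is
constant along `Ad` (`map_adjointCLM_eq`).
* Evaluation at a central `Z` is such a map; hence `Ad g` fixes the centre.
* Therefore `Ad g ∘ ad v = ad v`, every functional vanishing on the range of `ad` is such a map,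
  and `Ad g - 1` lies in that range (`adjointCLM_sub_id_mem_range`).
* As `ad U ∘ ad V = 0`, the map `g ↦ Ad g - 1` is a homomorphism to the additive group of the range
  of `ad`. By the inverse function theorem its image contains a neighbourhood of `0`, so it is
  everything (`adjointLogRange_eq_top`).
-/

open Filter Topology Set VectorField

/-! ### The multiplication in the chart around the identity -/

section Chart

variable {n : ℕ} {G : Type*} [TopologicalSpace G] [ChartedSpace (EuclideanSpace ℝ (Fin n)) G]
  [Group G]

variable (n G) in
/-- The preferred chart of `G` around the identity. -/
noncomputable abbrev oneChart : PartialEquiv G (EuclideanSpace ℝ (Fin n)) :=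
  extChartAt (𝓡 n) (1 : G)

variable (n G) in
/-- The coordinates of the identity in the preferred chart around it. -/
noncomputable abbrev oneCoord : EuclideanSpace ℝ (Fin n) := oneChart n G 1

variable (n G) in
/-- The multiplication of `G` read in the preferred chart around the identity. -/
noncomputable def chartMul (p : EuclideanSpace ℝ (Fin n) × EuclideanSpace ℝ (Fin n)) :
    EuclideanSpace ℝ (Fin n) :=
  oneChart n G ((oneChart n G).symm p.1 * (oneChart n G).symm p.2)

variable (n G) in
/-- The derivative of the multiplication in its second variable, at `(x, 1)`: the left-invariant
vector fields read in the chart. -/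
noncomputable def leftDeriv (x : EuclideanSpace ℝ (Fin n)) :
    EuclideanSpace ℝ (Fin n) →L[ℝ] EuclideanSpace ℝ (Fin n) :=
  (fderiv ℝ (chartMul n G) (x, oneCoord n G)).comp (ContinuousLinearMap.inr ℝ _ _)

variable (n G) in
/-- The derivative of the multiplication in its first variable, at `(1, x)`: the right-invariant
vector fields read in the chart. -/
noncomputable def rightDeriv (x : EuclideanSpace ℝ (Fin n)) :
    EuclideanSpace ℝ (Fin n) →L[ℝ] EuclideanSpace ℝ (Fin n) :=
  (fderiv ℝ (chartMul n G) (oneCoord n G, x)).comp (ContinuousLinearMap.inl ℝ _ _)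

@[simp] theorem oneChart_symm_oneCoord : (oneChart n G).symm (oneCoord n G) = 1 :=
  extChartAt_to_inv _

theorem contMDiffAt_oneChart_symm :
    ContMDiffAt 𝓘(ℝ, EuclideanSpace ℝ (Fin n)) (𝓡 n) ∞ (oneChart n G).symm (oneCoord n G) := by
  have := contMDiffWithinAt_extChartAt_symm_range_self (I := 𝓡 n) (n := ∞) (1 : G)
  rwa [ModelWithCorners.range_eq_univ, contMDiffWithinAt_univ] at this

variable [LieGroup (𝓡 n) ∞ G]

theorem contDiffAt_chartMul :
    ContDiffAt ℝ ∞ (chartMul n G) (oneCoord n G, oneCoord n G) := by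
  rw [← contMDiffAt_iff_contDiffAt]
  have h1 : ContMDiffAt 𝓘(ℝ, EuclideanSpace ℝ (Fin n) × EuclideanSpace ℝ (Fin n))
      (𝓡 n) ∞ (fun p : EuclideanSpace ℝ (Fin n) × EuclideanSpace ℝ (Fin n) =>
        (oneChart n G).symm p.1 * (oneChart n G).symm p.2) (oneCoord n G, oneCoord n G) :=
    (contMDiffAt_oneChart_symm.comp (oneCoord n G, oneCoord n G) contDiffAt_fst.contMDiffAt).mul
      (contMDiffAt_oneChart_symm.comp (oneCoord n G, oneCoord n G) contDiffAt_snd.contMDiffAt)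
  refine ContMDiffAt.comp_of_eq (I' := 𝓡 n) (g := oneChart n G)
    (contMDiffAt_extChartAt (I := 𝓡 n) (x := (1 : G))) h1 ?_
  rw [oneChart_symm_oneCoord, mul_one]

theorem eventually_differentiableAt_chartMul :
    ∀ᶠ p in 𝓝 (oneCoord n G, oneCoord n G), DifferentiableAt ℝ (chartMul n G) p := by
  filter_upwards [((contDiffAt_chartMul (n := n) (G := G)).of_le (m := 1) (by simp)).eventually
    (by simp)] with p hp
  exact hp.differentiableAt (by simp)

theorem contDiffAt_fderiv_chartMul :
    ContDiffAt ℝ ∞ (fderiv ℝ (chartMul n G)) (oneCoord n G, oneCoord n G) :=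
  contDiffAt_chartMul.fderiv_right (by simp)

theorem contDiffAt_leftDeriv : ContDiffAt ℝ ∞ (leftDeriv n G) (oneCoord n G) := by
  have h : ContDiffAt ℝ ∞ (fun x => fderiv ℝ (chartMul n G) (x, oneCoord n G)) (oneCoord n G) :=
    contDiffAt_fderiv_chartMul.comp (f := fun x => (x, oneCoord n G)) (oneCoord n G)
      (contDiffAt_id.prodMk contDiffAt_const)
  exact h.clm_comp contDiffAt_const

theorem contDiffAt_rightDeriv : ContDiffAt ℝ ∞ (rightDeriv n G) (oneCoord n G) := by
  have h : ContDiffAt ℝ ∞ (fun x => fderiv ℝ (chartMul n G) (oneCoord n G, x)) (oneCoord n G) :=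
    contDiffAt_fderiv_chartMul.comp (f := fun x => (oneCoord n G, x)) (oneCoord n G)
      (contDiffAt_const.prodMk contDiffAt_id)
  exact h.clm_comp contDiffAt_const

/-- Left- and right-invariant vector fields commute: this is the symmetry of the second derivative
of the multiplication. -/
theorem fderiv_rightDeriv_apply (v w : EuclideanSpace ℝ (Fin n)) :
    fderiv ℝ (rightDeriv n G) (oneCoord n G) v w =
      fderiv ℝ (leftDeriv n G) (oneCoord n G) w v := by
  have hd := (contDiffAt_fderiv_chartMul (n := n) (G := G)).differentiableAt (by simp)
  have hr : HasFDerivAt (rightDeriv n G) _ (oneCoord n G) :=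
    HasFDerivAt.clm_comp (hd.hasFDerivAt.comp (f := fun x => (oneCoord n G, x)) (oneCoord n G)
      ((hasFDerivAt_const _ _).prodMk (hasFDerivAt_id _))) (hasFDerivAt_const _ _)
  have hl : HasFDerivAt (leftDeriv n G) _ (oneCoord n G) :=
    HasFDerivAt.clm_comp (hd.hasFDerivAt.comp (f := fun x => (x, oneCoord n G)) (oneCoord n G)
      ((hasFDerivAt_id _).prodMk (hasFDerivAt_const _ _))) (hasFDerivAt_const _ _)
  have hs : IsSymmSndFDerivAt ℝ (chartMul n G) (oneCoord n G, oneCoord n G) :=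
    contDiffAt_chartMul.isSymmSndFDerivAt
      (by rw [minSmoothness_of_isRCLikeNormedField]; exact ENat.LEInfty.out)
  rw [hr.fderiv, hl.fderiv]
  simpa using hs (0, v) (w, 0)

theorem hasMFDerivAt_oneChart_symm :
    HasMFDerivAt 𝓘(ℝ, EuclideanSpace ℝ (Fin n)) (𝓡 n) (oneChart n G).symm (oneCoord n G)
      (ContinuousLinearMap.id ℝ (EuclideanSpace ℝ (Fin n))) := by
  have h := (contMDiffAt_oneChart_symm (n := n) (G := G)).mdifferentiableAt (by simp)
  have h' := mfderivWithin_range_extChartAt_symm (I := 𝓡 n) (x := (1 : G))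
  rw [ModelWithCorners.range_eq_univ, mfderivWithin_univ] at h'
  exact h' ▸ h.hasMFDerivAt

/-- A function composed with the inverse chart has, at the coordinates of the identity, the same
derivative as the function itself at the identity. -/
theorem HasMFDerivAt.comp_oneChart_symm {F : Type*} [NormedAddCommGroup F] [NormedSpace ℝ F]
    {f : G → F} {f' : EuclideanSpace ℝ (Fin n) →L[ℝ] F}
    (hf : HasMFDerivAt (𝓡 n) 𝓘(ℝ, F) f 1 f') :
    HasFDerivAt (f ∘ (oneChart n G).symm) f' (oneCoord n G) := by
  have hf' : HasMFDerivAt (𝓡 n) 𝓘(ℝ, F) f ((oneChart n G).symm (oneCoord n G)) f' := by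
    rw [oneChart_symm_oneCoord]
    exact hf
  exact (hf'.comp _ hasMFDerivAt_oneChart_symm).hasFDerivAt

end Chart

section Adjoint

variable {n : ℕ} {G : Type*} [TopologicalSpace G] [ChartedSpace (EuclideanSpace ℝ (Fin n)) G]
  [Group G]

theorem eventually_oneChart_symm_mem_source :
    ∀ᶠ x in 𝓝 (oneCoord n G), (oneChart n G).symm x ∈ (oneChart n G).source := by
  filter_upwards [extChartAt_target_mem_nhds (I := 𝓡 n) (1 : G)] with x hx
  exact (oneChart n G).map_target hx

variable [LieGroup (𝓡 n) ∞ G]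

theorem mdifferentiableAt_const_mul_lieGroup {g h : G} :
    MDifferentiableAt (𝓡 n) (𝓡 n) (fun x : G => g * x) h :=
  (contMDiff_mul_left (I := 𝓡 n) (n := ∞)).contMDiffAt.mdifferentiableAt (by simp)

theorem mdifferentiableAt_mul_const_lieGroup {g h : G} :
    MDifferentiableAt (𝓡 n) (𝓡 n) (fun x : G => x * g) h :=
  (contMDiff_mul_right (I := 𝓡 n) (n := ∞)).contMDiffAt.mdifferentiableAt (by simp)

/-- `leftDeriv` is the left-invariant vector field pushed to the chart. -/
theorem leftDeriv_apply_eventually :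
    ∀ᶠ x in 𝓝 (oneCoord n G), ∀ v : EuclideanSpace ℝ (Fin n), leftDeriv n G x v =
      mfderiv (𝓡 n) 𝓘(ℝ, EuclideanSpace ℝ (Fin n)) (oneChart n G) ((oneChart n G).symm x)
        (mulInvariantVectorField (I := 𝓡 n) (G := G) v ((oneChart n G).symm x)) := by
  have hc : ContinuousAt (fun x => (x, oneCoord n G)) (oneCoord n G) := by fun_prop
  filter_upwards [hc.eventually eventually_differentiableAt_chartMul,
    eventually_oneChart_symm_mem_source] with x hx hxs v
  have h1 : HasFDerivAt (fun y => chartMul n G (x, y)) (leftDeriv n G x) (oneCoord n G) :=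
    hx.hasFDerivAt.comp (oneCoord n G) (hasFDerivAt_prodMk_right x (oneCoord n G))
  have hφ : HasMFDerivAt (𝓡 n) 𝓘(ℝ, EuclideanSpace ℝ (Fin n)) (oneChart n G)
      ((oneChart n G).symm x * 1) (mfderiv (𝓡 n) 𝓘(ℝ, EuclideanSpace ℝ (Fin n)) (oneChart n G)
        ((oneChart n G).symm x)) := by
    rw [mul_one]
    exact (mdifferentiableAt_extChartAt (by simpa using hxs)).hasMFDerivAt
  have h2 := HasMFDerivAt.comp_oneChart_symm
    (hφ.comp (1 : G) mdifferentiableAt_const_mul_lieGroup.hasMFDerivAt)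
  exact congrArg (fun T => T v) (h1.unique h2)

/-- `rightDeriv` is the right-invariant vector field pushed to the chart. -/
theorem rightDeriv_apply_eventually :
    ∀ᶠ x in 𝓝 (oneCoord n G), ∀ v : EuclideanSpace ℝ (Fin n), rightDeriv n G x v =
      mfderiv (𝓡 n) 𝓘(ℝ, EuclideanSpace ℝ (Fin n)) (oneChart n G) ((oneChart n G).symm x)
        (mfderiv (𝓡 n) (𝓡 n) (fun y : G => y * (oneChart n G).symm x) 1 v) := by
  have hc : ContinuousAt (fun x => (oneCoord n G, x)) (oneCoord n G) := by fun_prop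
  filter_upwards [hc.eventually eventually_differentiableAt_chartMul,
    eventually_oneChart_symm_mem_source] with x hx hxs v
  have h1 : HasFDerivAt (fun y => chartMul n G (y, x)) (rightDeriv n G x) (oneCoord n G) :=
    hx.hasFDerivAt.comp (f := fun y => (y, x)) (oneCoord n G)
      (hasFDerivAt_prodMk_left (oneCoord n G) x)
  have hφ : HasMFDerivAt (𝓡 n) 𝓘(ℝ, EuclideanSpace ℝ (Fin n)) (oneChart n G)
      (1 * (oneChart n G).symm x) (mfderiv (𝓡 n) 𝓘(ℝ, EuclideanSpace ℝ (Fin n)) (oneChart n G)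
        ((oneChart n G).symm x)) := by
    rw [one_mul]
    exact (mdifferentiableAt_extChartAt (by simpa using hxs)).hasMFDerivAt
  have h2 := HasMFDerivAt.comp_oneChart_symm
    (hφ.comp (1 : G) mdifferentiableAt_mul_const_lieGroup.hasMFDerivAt)
  exact congrArg (fun T => T v) (h1.unique h2)

theorem rightDeriv_oneCoord :
    rightDeriv n G (oneCoord n G) = ContinuousLinearMap.id ℝ (EuclideanSpace ℝ (Fin n)) := by
  have h1 : HasFDerivAt (fun y => chartMul n G (y, oneCoord n G))
      (rightDeriv n G (oneCoord n G)) (oneCoord n G) :=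
    eventually_differentiableAt_chartMul.self_of_nhds.hasFDerivAt.comp
      (f := fun y => (y, oneCoord n G)) (oneCoord n G)
      (hasFDerivAt_prodMk_left (oneCoord n G) (oneCoord n G))
  refine h1.unique ((hasFDerivAt_id _).congr_of_eventuallyEq ?_)
  filter_upwards [extChartAt_target_mem_nhds (I := 𝓡 n) (1 : G)] with x hx
  simp only [chartMul, oneChart_symm_oneCoord, mul_one]
  exact (oneChart n G).right_inv hx

/-! ### The adjoint action and its differential -/

variable (n) in
/-- The adjoint action as a continuous linear map of the model space, in which the Lie algebra, as
the tangent space at the identity, is realized. -/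
noncomputable def adjointCLM (g : G) : EuclideanSpace ℝ (Fin n) →L[ℝ] EuclideanSpace ℝ (Fin n) :=
  mfderiv (𝓡 n) (𝓡 n) (fun x : G => g * x * g⁻¹) 1

theorem mdifferentiableAt_conj {g h : G} :
    MDifferentiableAt (𝓡 n) (𝓡 n) (fun x : G => g * x * g⁻¹) h :=
  (mdifferentiableAt_mul_const_lieGroup (n := n) (g := g⁻¹)).comp h
    mdifferentiableAt_const_mul_lieGroup

theorem hasMFDerivAt_conj (g : G) :
    HasMFDerivAt (𝓡 n) (𝓡 n) (fun x : G => g * x * g⁻¹) 1 (adjointCLM n g) :=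
  mdifferentiableAt_conj.hasMFDerivAt

theorem adjointCLM_mul (g h : G) :
    adjointCLM n (g * h) = (adjointCLM n g).comp (adjointCLM n h) := by
  have hg : HasMFDerivAt (𝓡 n) (𝓡 n) (fun x : G => g * x * g⁻¹) (h * 1 * h⁻¹)
      (adjointCLM n g) := by
    rw [mul_one, mul_inv_cancel]
    exact hasMFDerivAt_conj g
  have h1 := hg.comp (1 : G) (hasMFDerivAt_conj h)
  have h2 := hasMFDerivAt_conj (n := n) (g * h)
  have e : (fun x : G => g * h * x * (g * h)⁻¹) =
      (fun x : G => g * x * g⁻¹) ∘ (fun x : G => h * x * h⁻¹) := by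
    ext x; simp [mul_assoc]
  rw [e] at h2
  exact hasMFDerivAt_unique h2 h1

@[simp] theorem adjointCLM_one :
    adjointCLM n (1 : G) = ContinuousLinearMap.id ℝ (EuclideanSpace ℝ (Fin n)) := by
  have h := hasMFDerivAt_conj (n := n) (1 : G)
  have e : (fun x : G => (1 : G) * x * (1 : G)⁻¹) = id := by ext x; simp
  rw [e] at h
  exact hasMFDerivAt_unique h (hasMFDerivAt_id _)

/-- Left-invariant fields in terms of right-invariant ones: `dL_g v = dR_g (Ad_g v)`. -/
theorem mfderiv_mul_right_adjointCLM (g : G) (v : EuclideanSpace ℝ (Fin n)) :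
    mfderiv (𝓡 n) (𝓡 n) (fun y : G => y * g) 1 (adjointCLM n g v) =
      mulInvariantVectorField (I := 𝓡 n) (G := G) v g := by
  have hg : HasMFDerivAt (𝓡 n) (𝓡 n) (fun y : G => y * g) (g * 1 * g⁻¹)
      (mfderiv (𝓡 n) (𝓡 n) (fun y : G => y * g) 1) := by
    rw [mul_one, mul_inv_cancel]
    exact mdifferentiableAt_mul_const_lieGroup.hasMFDerivAt
  have h1 := hg.comp (1 : G) (hasMFDerivAt_conj g)
  have e : (fun y : G => y * g) ∘ (fun x : G => g * x * g⁻¹) = fun x => g * x := by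
    ext x; simp
  rw [e] at h1
  exact congrArg (fun T : EuclideanSpace ℝ (Fin n) →L[ℝ] EuclideanSpace ℝ (Fin n) => T v)
    (hasMFDerivAt_unique h1 mdifferentiableAt_const_mul_lieGroup.hasMFDerivAt)

theorem rightDeriv_comp_adjointCLM_eventually :
    ∀ᶠ x in 𝓝 (oneCoord n G), (rightDeriv n G x).comp (adjointCLM n ((oneChart n G).symm x)) =
      leftDeriv n G x := by
  filter_upwards [leftDeriv_apply_eventually (n := n) (G := G), rightDeriv_apply_eventually]
    with x hl hr
  ext1 v
  rw [hl, ContinuousLinearMap.comp_apply, hr, mfderiv_mul_right_adjointCLM]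

/-- Near the identity, `Ad` is the composition of the inverse of `rightDeriv` with `leftDeriv`. -/
theorem contDiffAt_adjointCLM :
    ContDiffAt ℝ ∞ (fun x => adjointCLM n ((oneChart n G).symm x)) (oneCoord n G) := by
  have hinv : (rightDeriv n G (oneCoord n G)).IsInvertible := by
    rw [rightDeriv_oneCoord]
    exact ⟨ContinuousLinearEquiv.refl ℝ _, rfl⟩
  have h1 : ContDiffAt ℝ ∞ (fun x => (rightDeriv n G x).inverse) (oneCoord n G) := by
    have := hinv.contDiffAt_map_inverse (n := ∞)
    exact this.comp (oneCoord n G) contDiffAt_rightDeriv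
  refine (h1.clm_comp contDiffAt_leftDeriv).congr_of_eventuallyEq ?_
  have hu : ∀ᶠ x in 𝓝 (oneCoord n G), (rightDeriv n G x).IsInvertible := by
    have : ∀ᶠ T in 𝓝 (rightDeriv n G (oneCoord n G)), T.IsInvertible := by
      obtain ⟨T, hT⟩ := hinv
      rw [← hT]
      exact ContinuousLinearEquiv.nhds T
    exact contDiffAt_rightDeriv.continuousAt.eventually this
  filter_upwards [hu, rightDeriv_comp_adjointCLM_eventually (n := n) (G := G)] with x hx hxe
  obtain ⟨T, hT⟩ := hx
  rw [← hxe, ← hT, ContinuousLinearMap.inverse_equiv]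
  ext1 v
  simp

/-- The derivative of `Ad` at the identity, obtained by differentiating
`rightDeriv x ∘ Ad (φ⁻¹ x) = leftDeriv x`. -/
theorem fderiv_adjointCLM_apply (v w : EuclideanSpace ℝ (Fin n)) :
    fderiv ℝ (fun x => adjointCLM n ((oneChart n G).symm x)) (oneCoord n G) v w =
      fderiv ℝ (leftDeriv n G) (oneCoord n G) v w -
        fderiv ℝ (leftDeriv n G) (oneCoord n G) w v := by
  have hA := ((contDiffAt_adjointCLM (n := n) (G := G)).differentiableAt (by simp)).hasFDerivAt
  have hr := ((contDiffAt_rightDeriv (n := n) (G := G)).differentiableAt (by simp)).hasFDerivAt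
  have hl := ((contDiffAt_leftDeriv (n := n) (G := G)).differentiableAt (by simp)).hasFDerivAt
  have h := (hr.clm_comp hA).unique
    (hl.congr_of_eventuallyEq rightDeriv_comp_adjointCLM_eventually)
  have h' := congrArg (fun T => T v w) h
  simp only [oneChart_symm_oneCoord, adjointCLM_one, rightDeriv_oneCoord] at h'
  rw [← fderiv_rightDeriv_apply v w, ← h']
  simp

/-- The bracket of the Lie algebra is that of the left-invariant fields `x ↦ leftDeriv x v` and
`x ↦ leftDeriv x w` of the model space, because the preferred chart at `1` has the identity as its
derivative at `1`. -/
theorem groupLieAlgebra_bracket_eq (v w : GroupLieAlgebra (𝓡 n) G) :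
    ⁅v, w⁆ = fderiv ℝ (leftDeriv n G) (oneCoord n G) v w -
        fderiv ℝ (leftDeriv n G) (oneCoord n G) w v := by
  have key (u : GroupLieAlgebra (𝓡 n) G) :
      mpullbackWithin 𝓘(ℝ, EuclideanSpace ℝ (Fin n)) (𝓡 n) (oneChart n G).symm
        (mulInvariantVectorField u) (range (𝓡 n)) =ᶠ[𝓝 (oneCoord n G)]
          fun x => leftDeriv n G x u := by
    filter_upwards [leftDeriv_apply_eventually (n := n) (G := G),
      extChartAt_target_mem_nhds (I := 𝓡 n) (1 : G)] with x hx hxt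
    refine Eq.trans ?_ (hx u).symm
    have hinv := ContinuousLinearMap.inverse_eq
      (mfderivWithin_extChartAt_symm_comp_mfderiv_extChartAt hxt)
      (mfderiv_extChartAt_comp_mfderivWithin_extChartAt_symm hxt)
    exact congrArg (fun T : EuclideanSpace ℝ (Fin n) →L[ℝ] EuclideanSpace ℝ (Fin n) =>
      T (mulInvariantVectorField (I := 𝓡 n) u ((oneChart n G).symm x))) hinv
  have hl (u : EuclideanSpace ℝ (Fin n)) : HasFDerivAt (fun x => leftDeriv n G x u) _ _ :=
    ((contDiffAt_leftDeriv (n := n) (G := G)).differentiableAt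
      (by simp)).hasFDerivAt.clm_apply (hasFDerivAt_const u _)
  have hLie {V W : EuclideanSpace ℝ (Fin n) → EuclideanSpace ℝ (Fin n)}
      (hV : V =ᶠ[𝓝 (oneCoord n G)] fun x => leftDeriv n G x v)
      (hW : W =ᶠ[𝓝 (oneCoord n G)] fun x => leftDeriv n G x w) :
      lieBracketWithin ℝ V W (range (𝓡 n)) (oneCoord n G) =
        lieBracket ℝ (fun x => leftDeriv n G x v) (fun x => leftDeriv n G x w) (oneCoord n G) := by
    rw [ModelWithCorners.range_eq_univ, lieBracketWithin_univ]
    exact hV.lieBracket_vectorField_eq hW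
  have hid : ((mfderiv (𝓡 n) 𝓘(ℝ, EuclideanSpace ℝ (Fin n)) (oneChart n G) 1).inverse :
      EuclideanSpace ℝ (Fin n) →L[ℝ] EuclideanSpace ℝ (Fin n)) = ContinuousLinearMap.id ℝ _ :=
    (congrArg (fun T : EuclideanSpace ℝ (Fin n) →L[ℝ] EuclideanSpace ℝ (Fin n) => T.inverse)
      (mfderiv_extChartAt_self (I := 𝓡 n) (x := (1 : G)))).trans ContinuousLinearMap.inverse_id
  rw [GroupLieAlgebra.bracket_def, ← mlieBracketWithin_univ, mlieBracketWithin_apply,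
    preimage_univ, univ_inter]
  refine (congrArg (fun T : EuclideanSpace ℝ (Fin n) →L[ℝ] EuclideanSpace ℝ (Fin n) => T _)
    hid).trans ((hLie (key v) (key w)).trans ?_)
  have hL : leftDeriv n G (oneCoord n G) = ContinuousLinearMap.id ℝ _ := by
    have h := (rightDeriv_comp_adjointCLM_eventually (n := n) (G := G)).self_of_nhds
    rw [rightDeriv_oneCoord, oneChart_symm_oneCoord, adjointCLM_one] at h
    exact h.symm
  rw [lieBracket, (hl v).fderiv, (hl w).fderiv, hL]
  simp only [ContinuousLinearMap.comp_zero, zero_add]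
  rfl

end Adjoint

/-! ### Functions with zero derivative on a connected Lie group -/

section Constancy

variable {n : ℕ} {G : Type*} [TopologicalSpace G] [ChartedSpace (EuclideanSpace ℝ (Fin n)) G]
  {W : Type*} [NormedAddCommGroup W] [NormedSpace ℝ W]

/-- A function on a manifold with zero derivative is locally constant. -/
theorem isLocallyConstant_of_hasMFDerivAt_zero [IsManifold (𝓡 n) 1 G] {f : G → W}
    (hf : ∀ g, HasMFDerivAt (𝓡 n) 𝓘(ℝ, W) f g 0) : IsLocallyConstant f := by
  intro t
  rw [isOpen_iff_mem_nhds]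
  intro g hg
  have hd : ∀ y ∈ (extChartAt (𝓡 n) g).target,
      HasFDerivAt (f ∘ (extChartAt (𝓡 n) g).symm) (0 : EuclideanSpace ℝ (Fin n) →L[ℝ] W) y := by
    intro y hy
    have h1 := mdifferentiableWithinAt_extChartAt_symm hy
    rw [ModelWithCorners.range_eq_univ, mdifferentiableWithinAt_univ] at h1
    have h2 := (hf _).comp y h1.hasMFDerivAt
    rw [ContinuousLinearMap.zero_comp] at h2
    exact h2.hasFDerivAt
  have ho := (isOpen_extChartAt_target (I := 𝓡 n) g).isOpen_inter_preimage_of_fderiv_eq_zero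
    (fun y hy => (hd y hy).differentiableAt.differentiableWithinAt)
    (fun y hy => (hd y hy).fderiv) t
  have hmem : (extChartAt (𝓡 n) g).target ∩ (f ∘ (extChartAt (𝓡 n) g).symm) ⁻¹' t ∈
      𝓝 (extChartAt (𝓡 n) g g) :=
    ho.mem_nhds ⟨mem_extChartAt_target g, by simpa using hg⟩
  filter_upwards [(continuousAt_extChartAt (I := 𝓡 n) g).preimage_mem_nhds hmem,
    extChartAt_source_mem_nhds (I := 𝓡 n) g] with h hh hs
  have := hh.2
  simpa only [mem_preimage, Function.comp_apply, (extChartAt (𝓡 n) g).left_inv hs] using this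

/-- A function on a connected Lie group is constant if the derivatives at the identity of all its
left translates vanish. -/
theorem eq_apply_one_of_hasFDerivAt_zero [Group G] [LieGroup (𝓡 n) ∞ G] [ConnectedSpace G]
    {f : G → W} (hf : ∀ g, HasFDerivAt (fun x => f (g * (oneChart n G).symm x))
      (0 : EuclideanSpace ℝ (Fin n) →L[ℝ] W) (oneCoord n G)) (g : G) : f g = f 1 := by
  refine IsLocallyConstant.apply_eq_of_preconnectedSpace
    (isLocallyConstant_of_hasMFDerivAt_zero (n := n) fun a => ?_) g 1
  have hφ : HasMFDerivAt (𝓡 n) 𝓘(ℝ, EuclideanSpace ℝ (Fin n)) (oneChart n G) (a⁻¹ * a)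
      (ContinuousLinearMap.id ℝ (EuclideanSpace ℝ (Fin n))) := by
    rw [inv_mul_cancel]
    exact mfderiv_extChartAt_self (I := 𝓡 n) (x := (1 : G)) ▸
      (mdifferentiableAt_extChartAt (by simp)).hasMFDerivAt
  have hfa : HasMFDerivAt 𝓘(ℝ, EuclideanSpace ℝ (Fin n)) 𝓘(ℝ, W)
      (fun x => f (a * (oneChart n G).symm x)) (oneChart n G (a⁻¹ * a)) 0 := by
    rw [inv_mul_cancel]
    exact (hf a).hasMFDerivAt
  have h := (hfa.comp (a⁻¹ * a) hφ).comp a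
    (mdifferentiableAt_const_mul_lieGroup (n := n) (g := a⁻¹) (h := a)).hasMFDerivAt
  have h0 : HasMFDerivAt (𝓡 n) 𝓘(ℝ, W)
      ((fun x => f (a * (oneChart n G).symm x)) ∘ oneChart n G ∘ fun b => a⁻¹ * b) a 0 := by
    convert! h using 1
  refine h0.congr_of_eventuallyEq ?_
  have hc : ContinuousAt (fun b : G => a⁻¹ * b) a :=
    (mdifferentiableAt_const_mul_lieGroup (n := n)).continuousAt
  have hs : (oneChart n G).source ∈ 𝓝 (a⁻¹ * a) := by
    rw [inv_mul_cancel]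
    exact extChartAt_source_mem_nhds (I := 𝓡 n) (1 : G)
  filter_upwards [hc.preimage_mem_nhds hs] with b hb
  simp only [Function.comp_apply]
  rw [(oneChart n G).left_inv hb, mul_inv_cancel_left]

end Constancy

/-! ### Subgroups of a vector space containing the image of a submersion -/

/-- An additive subgroup of the range of `f'` is everything if it contains the values of a map `f`
with values in that range, vanishing at `a` and with strict derivative `f'` there: by the inverse
function theorem it is a neighbourhood of `0`, and vector spaces are connected. -/
theorem AddSubgroup.eq_top_of_hasStrictFDerivAt {E F : Type*} [NormedAddCommGroup E]
    [NormedSpace ℝ E] [CompleteSpace E] [NormedAddCommGroup F] [NormedSpace ℝ F]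
    [FiniteDimensional ℝ F] {f : E → F} {f' : E →L[ℝ] F} {a : E} (hf : HasStrictFDerivAt f f' a)
    (ha : f a = 0) (hmem : ∀ x, f x ∈ f'.range) {H : AddSubgroup f'.range}
    (hH : ∀ x, ⟨f x, hmem x⟩ ∈ H) : H = ⊤ := by
  obtain ⟨P, hP⟩ := Submodule.ClosedComplemented.of_finiteDimensional f'.range
  have hd : HasStrictFDerivAt (fun x => P (f x)) (P.comp f') a := P.hasStrictFDerivAt.comp a hf
  have hsurj : (P.comp f').range = ⊤ := by
    rw [LinearMap.range_eq_top]
    rintro ⟨_, v, rfl⟩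
    exact ⟨v, hP ⟨_, v, rfl⟩⟩
  have hmap := hd.map_nhds_eq_of_surj hsurj
  rw [ha, map_zero] at hmap
  have hnhds : (H : Set f'.range) ∈ 𝓝 0 := by
    rw [← hmap, Filter.mem_map]
    refine univ_mem' fun x => ?_
    have h : P (f x) = ⟨f x, hmem x⟩ := hP ⟨f x, hmem x⟩
    rw [mem_preimage, h]
    exact hH x
  have hopen := H.isOpen_of_mem_nhds hnhds
  have hclopen : IsClopen (H : Set f'.range) := ⟨H.isClosed_of_isOpen hopen, hopen⟩
  exact SetLike.coe_injective (hclopen.eq_univ ⟨0, zero_mem _⟩)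

/-! ### The image of `Ad` for a step-two nilpotent group -/

section StepTwo

variable {n : ℕ} {G : Type*} [TopologicalSpace G] [ChartedSpace (EuclideanSpace ℝ (Fin n)) G]
  [Group G] [LieGroup (𝓡 n) ∞ G]

variable (n G) in
/-- The adjoint representation `v ↦ ad v` of the Lie algebra, on the model space: by
`adCLM_apply`, it is the differential of `Ad` at the identity. -/
noncomputable def adCLM : EuclideanSpace ℝ (Fin n) →L[ℝ]
    EuclideanSpace ℝ (Fin n) →L[ℝ] EuclideanSpace ℝ (Fin n) :=
  fderiv ℝ (fun x => adjointCLM n ((oneChart n G).symm x)) (oneCoord n G)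

theorem adCLM_apply (v w : GroupLieAlgebra (𝓡 n) G) : adCLM n G v w = ⁅v, w⁆ := by
  rw [groupLieAlgebra_bracket_eq]
  exact fderiv_adjointCLM_apply v w

theorem hasStrictFDerivAt_adjointCLM :
    HasStrictFDerivAt (fun x => adjointCLM n ((oneChart n G).symm x)) (adCLM n G)
      (oneCoord n G) :=
  contDiffAt_adjointCLM.hasStrictFDerivAt (by simp)

/-- As `Ad (g * h) = Ad g ∘ Ad h`, the derivative of `Ad` along the left-invariant field of `v` is
`g ↦ Ad g ∘ ad v`. A linear map killing all of these is constant along `Ad`. -/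
theorem map_adjointCLM_eq [ConnectedSpace G] {W : Type*} [NormedAddCommGroup W] [NormedSpace ℝ W]
    (ℓ : (EuclideanSpace ℝ (Fin n) →L[ℝ] EuclideanSpace ℝ (Fin n)) →L[ℝ] W)
    (hℓ : ∀ (g : G) (v : EuclideanSpace ℝ (Fin n)),
      ℓ ((adjointCLM n g).comp (adCLM n G v)) = 0) (g : G) :
    ℓ (adjointCLM n g) = ℓ (ContinuousLinearMap.id ℝ _) := by
  rw [← adjointCLM_one (G := G)]
  refine eq_apply_one_of_hasFDerivAt_zero (n := n) (f := fun g => ℓ (adjointCLM n g))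
    (fun a => ?_) g
  have h := (ℓ.comp (ContinuousLinearMap.compL ℝ _ _ _ (adjointCLM n a))).hasFDerivAt.comp
    (oneCoord n G) (hasStrictFDerivAt_adjointCLM (n := n) (G := G)).hasFDerivAt
  convert! h using 1
  · ext x
    simp [adjointCLM_mul]
  · ext v
    simp [hℓ]

theorem adCLM_comp_adCLM (hG : IsStepTwoNilpotent (GroupLieAlgebra (𝓡 n) G))
    (v w : GroupLieAlgebra (𝓡 n) G) : (adCLM n G v).comp (adCLM n G w) = 0 := by
  refine ContinuousLinearMap.ext fun (u : GroupLieAlgebra (𝓡 n) G) => ?_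
  have h1 := adCLM_apply (n := n) (G := G) w u
  have h2 := adCLM_apply (n := n) (G := G) v ⁅w, u⁆
  exact (congrArg (adCLM n G v) h1).trans (h2.trans (hG w u v))

variable [ConnectedSpace G]

theorem adjointCLM_apply_of_mem_center (g : G) {Z : GroupLieAlgebra (𝓡 n) G}
    (hZ : Z ∈ LieAlgebra.center ℝ (GroupLieAlgebra (𝓡 n) G)) : adjointCLM n g Z = Z := by
  refine map_adjointCLM_eq (n := n) (ContinuousLinearMap.apply ℝ (EuclideanSpace ℝ (Fin n)) Z)
    (fun a v => ?_) g
  have h : adCLM n G v Z = 0 := (adCLM_apply (n := n) (G := G) v Z).trans (hZ v)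
  exact (congrArg (adjointCLM n a) h).trans (map_zero _)

/-- Linear functionals vanishing on the range of `ad` are constant along `Ad`, because `Ad g` fixes
the values of `ad v`, which are central. -/
theorem adjointCLM_sub_id_mem_range (hG : IsStepTwoNilpotent (GroupLieAlgebra (𝓡 n) G)) (g : G) :
    adjointCLM n g - ContinuousLinearMap.id ℝ _ ∈ (adCLM n G).range := by
  by_contra hmem
  obtain ⟨f, hf, hle⟩ := Submodule.exists_le_ker_of_notMem hmem
  refine hf ?_
  have hc (a : G) (v : EuclideanSpace ℝ (Fin n)) :
      (adjointCLM n a).comp (adCLM n G v) = adCLM n G v := by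
    ext1 w
    have h := adCLM_apply (n := n) (G := G) v w
    rw [ContinuousLinearMap.comp_apply, h]
    exact adjointCLM_apply_of_mem_center a (hG v w)
  have h := map_adjointCLM_eq (LinearMap.toContinuousLinearMap f) (fun a v => by
    rw [hc]
    exact hle ⟨v, rfl⟩) g
  rw [map_sub, sub_eq_zero]
  exact h

/-- The set of `ad U` with `1 + ad U` in the image of `Ad`: it is an additive group as
`(1 + ad U) ∘ (1 + ad V) = 1 + (ad U + ad V)`. -/
noncomputable def adjointLogRange (hG : IsStepTwoNilpotent (GroupLieAlgebra (𝓡 n) G)) :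
    AddSubgroup (adCLM n G).range where
  carrier := {s | ∃ g : G, adjointCLM n g = ContinuousLinearMap.id ℝ _ + (s : _ →L[ℝ] _)}
  zero_mem' := ⟨1, by simp⟩
  add_mem' := by
    rintro ⟨_, v, rfl⟩ ⟨_, w, rfl⟩ ⟨g, hg⟩ ⟨h, hh⟩
    refine ⟨g * h, ?_⟩
    have := adCLM_comp_adCLM hG v w
    simp only [ContinuousLinearMap.coe_coe] at hg hh
    simp [adjointCLM_mul, hg, hh, this]
    abel
  neg_mem' := by
    rintro ⟨_, v, rfl⟩ ⟨g, hg⟩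
    refine ⟨g⁻¹, ?_⟩
    simp only [ContinuousLinearMap.coe_coe] at hg
    have h : (adjointCLM n g⁻¹).comp (adjointCLM n g) = ContinuousLinearMap.id ℝ _ := by
      rw [← adjointCLM_mul, inv_mul_cancel, adjointCLM_one]
    have h0 := adCLM_comp_adCLM hG v v
    -- The inverse of `1 + ad v` is `1 - ad v`, as `ad v ∘ ad v = 0`.
    have h' := congrArg (fun T => T.comp (ContinuousLinearMap.id ℝ _ - adCLM n G v)) h
    simp only [ContinuousLinearMap.comp_assoc, hg] at h'
    simpa [h0, sub_eq_add_neg] using h'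

theorem adjointLogRange_eq_top (hG : IsStepTwoNilpotent (GroupLieAlgebra (𝓡 n) G)) :
    adjointLogRange hG = ⊤ := by
  refine AddSubgroup.eq_top_of_hasStrictFDerivAt
    ((hasStrictFDerivAt_adjointCLM (n := n) (G := G)).sub_const (ContinuousLinearMap.id ℝ _))
    (by simp only [oneChart_symm_oneCoord, adjointCLM_one, sub_self])
    (fun x => adjointCLM_sub_id_mem_range hG ((oneChart n G).symm x)) fun x => ?_
  exact ⟨(oneChart n G).symm x, (add_sub_cancel _ _).symm⟩

theorem exists_adjointAction_apply_eq (hG : IsStepTwoNilpotent (GroupLieAlgebra (𝓡 n) G)) (g : G) :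
    ∃ U : GroupLieAlgebra (𝓡 n) G, ∀ X : GroupLieAlgebra (𝓡 n) G,
      adjointAction g X = X + ⁅U, X⁆ := by
  obtain ⟨U, hU⟩ := adjointCLM_sub_id_mem_range hG g
  refine ⟨U, fun X => ?_⟩
  refine Eq.trans ?_ (congrArg (X + ·) (adCLM_apply (n := n) (G := G) U X))
  exact congrArg (fun T : EuclideanSpace ℝ (Fin n) →L[ℝ] EuclideanSpace ℝ (Fin n) => T X)
    (eq_add_of_sub_eq' hU.symm)

theorem exists_forall_adjointAction_apply_eq (hG : IsStepTwoNilpotent (GroupLieAlgebra (𝓡 n) G))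
    (U : GroupLieAlgebra (𝓡 n) G) :
    ∃ g : G, ∀ X : GroupLieAlgebra (𝓡 n) G, adjointAction g X = X + ⁅U, X⁆ := by
  obtain ⟨g, hg⟩ : (⟨adCLM n G U, U, rfl⟩ : (adCLM n G).range) ∈ adjointLogRange hG := by
    rw [adjointLogRange_eq_top]
    trivial
  refine ⟨g, fun X => ?_⟩
  rw [← adCLM_apply]
  exact congrArg (fun T : EuclideanSpace ℝ (Fin n) →L[ℝ] EuclideanSpace ℝ (Fin n) => T X) hg

end StepTwo

/-! ### The transpose of `1 + ad U` -/

section Transpose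

variable {L : Type*} [LieRing L] [LieAlgebra ℝ L]
  {B : LinearMap.BilinForm ℝ L}

theorem apply_eq_zero_of_mem_centerPerp (hB : IsCentralScalarProduct B) {V Z : L}
    (hV : V ∈ centerPerp B) (hZ : Z ∈ LieAlgebra.center ℝ L) : B V Z = 0 := by
  rw [← hB.isSymm.eq Z V]
  exact hV Z hZ

variable [FiniteDimensional ℝ L]

theorem lie_perpPart_perpPart (hB : IsCentralScalarProduct B) (U X : L) :
    ⁅(perpPart hB U : L), (perpPart hB X : L)⁆ = ⁅U, X⁆ := by
  have hX : ⁅(perpPart hB U : L), (centerPart hB X : L)⁆ = 0 := (centerPart hB X).2 _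
  have hU : ⁅(centerPart hB U : L), X⁆ = 0 := by
    rw [← lie_skew, (centerPart hB U).2 X, neg_zero]
  calc ⁅(perpPart hB U : L), (perpPart hB X : L)⁆
      = ⁅(perpPart hB U : L), (perpPart hB X : L) + (centerPart hB X : L)⁆ := by
        rw [lie_add, hX, add_zero]
    _ = ⁅(perpPart hB U : L) + (centerPart hB U : L), X⁆ := by
        rw [perpPart_add_centerPart, add_lie, hU, add_zero]
    _ = ⁅U, X⁆ := by rw [perpPart_add_centerPart]

/-- The transpose of `ad U` is `Y ↦ j(Y_z) U_v`. -/
theorem apply_jMap_centerPart (hL : IsStepTwoNilpotent L) (hB : IsCentralScalarProduct B)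
    (Y U X : L) : B (jMap hB (centerPart hB Y) (perpPart hB U) : L) X = B Y ⁅U, X⁆ := by
  calc B (jMap hB (centerPart hB Y) (perpPart hB U) : L) X
      = B (jMap hB (centerPart hB Y) (perpPart hB U) : L)
          ((perpPart hB X : L) + (centerPart hB X : L)) := by rw [perpPart_add_centerPart]
    _ = B ⁅(perpPart hB U : L), (perpPart hB X : L)⁆ (centerPart hB Y : L) := by
        rw [map_add, apply_eq_zero_of_mem_centerPerp hB (Subtype.prop _) (centerPart hB X).2,
          add_zero, jMap_spec]
    _ = B (centerPart hB Y : L) ⁅U, X⁆ := by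
        rw [lie_perpPart_perpPart]
        exact hB.isSymm.eq _ _
    _ = B ((perpPart hB Y : L) + (centerPart hB Y : L)) ⁅U, X⁆ := by
        rw [map_add, LinearMap.add_apply,
          apply_eq_zero_of_mem_centerPerp hB (perpPart hB Y).2 (hL U X), zero_add]
    _ = B Y ⁅U, X⁆ := by rw [perpPart_add_centerPart]

theorem leftAdjointOfNondegenerate_eq_add_jMap (hL : IsStepTwoNilpotent L)
    (hB : IsCentralScalarProduct B) {φ : L →ₗ[ℝ] L} {U : L} (hφ : ∀ X, φ X = X + ⁅U, X⁆) (Y : L) :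
    B.leftAdjointOfNondegenerate hB.nondegenerate φ Y =
      Y + (jMap hB (centerPart hB Y) (perpPart hB U) : L) := by
  rw [← sub_eq_zero]
  refine hB.nondegenerate.1 _ fun X => ?_
  have h := LinearMap.BilinForm.isAdjointPairLeftAdjointOfNondegenerate B hB.nondegenerate φ Y X
  rw [map_sub, LinearMap.sub_apply, map_add, LinearMap.add_apply, apply_jMap_centerPart hL, h, hφ,
    map_add, sub_self]

theorem perpPart_surjective (hB : IsCentralScalarProduct B) :
    Function.Surjective (perpPart hB) :=
  fun V => ⟨V, Submodule.projectionOnto_apply_left hB.isCompl V⟩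

end Transpose

/-! ### Coadjoint orbits -/

theorem proposition2p1 {n : ℕ} {G : Type*} [TopologicalSpace G]
    [ChartedSpace (EuclideanSpace ℝ (Fin n)) G] [Group G] [LieGroup (𝓡 n) ∞ G]
    [ConnectedSpace G]
    (hG : IsStepTwoNilpotent (GroupLieAlgebra (𝓡 n) G))
    (B : LinearMap.BilinForm ℝ (GroupLieAlgebra (𝓡 n) G)) (hB : IsCentralScalarProduct B)
    (Y : GroupLieAlgebra (𝓡 n) G) :
    coadjointOrbit B hB.nondegenerate Y =
        Set.range (fun U : GroupLieAlgebra (𝓡 n) G =>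
          Y + (jMap hB (centerPart hB Y) (perpPart hB U) : GroupLieAlgebra (𝓡 n) G)) ∧
      coadjointOrbit B hB.nondegenerate Y =
        (AffineSubspace.mk' Y
          ((LinearMap.range (jMap hB (centerPart hB Y))).map (centerPerp B).subtype) :
          Set (GroupLieAlgebra (𝓡 n) G)) := by
  have hrange : coadjointOrbit B hB.nondegenerate Y =
      Set.range (fun U : GroupLieAlgebra (𝓡 n) G =>
        Y + (jMap hB (centerPart hB Y) (perpPart hB U) : GroupLieAlgebra (𝓡 n) G)) := by
    apply Set.Subset.antisymm
    · rintro _ ⟨g, rfl⟩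
      obtain ⟨U, hU⟩ := exists_adjointAction_apply_eq hG g
      exact ⟨U, (leftAdjointOfNondegenerate_eq_add_jMap hG hB hU Y).symm⟩
    · rintro _ ⟨U, rfl⟩
      obtain ⟨g, hg⟩ := exists_forall_adjointAction_apply_eq hG U
      exact ⟨g, leftAdjointOfNondegenerate_eq_add_jMap hG hB hg Y⟩
  refine ⟨hrange, ?_⟩
  rw [hrange]
  ext X
  rw [SetLike.mem_coe, AffineSubspace.mem_mk', vsub_eq_sub]
  constructor
  · rintro ⟨U, rfl⟩
    exact ⟨_, ⟨perpPart hB U, rfl⟩, (add_sub_cancel_left _ _).symm⟩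
  · rintro ⟨_, ⟨V, rfl⟩, hX⟩
    obtain ⟨U, rfl⟩ := perpPart_surjective hB V
    exact ⟨U, (eq_add_of_sub_eq' hX.symm).symm⟩
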